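/- Let $n$ be a positive integer, $\sigma>0$, $\rho\in(-\tfrac1n,1)$, $\mu\in\mathbb{R}^n$, and let $\Xi$ be the $n\times n$ matrix with ones on the diagonal and all off-diagonal entries equal to $\rho$. Let $\mathbf 1=(1,\dots,1)^{\mathsf T}\in\mathbb{R}^n$, let $P=I-\frac1n\mathbf 1\mathbf 1^{\mathsf T}$ be the centering matrix, let $\|\cdot\|$ be the Euclidean norm, and define $\chi(z)=Pz/\|Pz\|$ for $z\in\mathbb{R}^n$ with $Pz\neq 0$ (and $\chi(z)=0$ if $Pz=0$). Let $$M(a,b,z)=\sum_{k=0}^\infty\frac{a^{(k)}z^k}{b^{(k)}k!},\qquad a^{(0)}=1,\quad a^{(k)}=a(a+1)\cdots(a+k-1),$$ be the confluent hypergeometric function of the first kind, and for integers $m\ge 1$ and real $x$ put $$\varrho_m(x)=\frac{\Gamma\left(\frac{m+1}{2}\right)}{\sqrt2\,\Gamma\left(\frac{m+2}{2}\right)}\,x\,M\left(\tfrac12,\tfrac{m+2}{2},-\tfrac12x^2\right),$$ $$f_m(x)=1-\frac{m-1}{m}M\left(1,\tfrac m2+1,-\tfrac{x^2}{2}\right)-\varrho_m(x)^2,\qquad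 g_m(x)=\frac1m M\left(1,\tfrac m2+1,-\tfrac{x^2}{2}\right).$$ Theorem. Let $Z\sim N(\mu,\sigma^2\Xi)$ be a normally distributed random vector in $\mathbb{R}^n$. Then for every $\theta\in\mathbb{R}^n$ with $\|\theta\|=1$ and $\mathbf 1^{\mathsf T}\theta=0$ (such $\theta$ exist only if $n\ge2$), $$\operatorname{var}\left(\theta^{\mathsf T}\chi(Z)\right)=\left[f_{n-1}(s)-g_{n-1}(s)\right]\left(\chi(\mu)^{\mathsf T}\theta\right)^2+g_{n-1}(s),\qquad s=\frac{\|P\mu\|}{\sigma\sqrt{1-\rho}}.$$ (If $P\mu=0$, then $s=0$ and the bracket is zero, so the value assigned to $\chi(\mu)$ plays no role.) -/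

import Mathlib

open MeasureTheory ProbabilityTheory Matrix

noncomputable section

namespace Standardization

/-- The centering matrix `P = I - (1/n) 𝟏 𝟏ᵀ`. -/
def centeringMatrix (n : ℕ) : Matrix (Fin n) (Fin n) ℝ :=
  1 - (1 / (n : ℝ)) • Matrix.vecMulVec (fun _ => (1 : ℝ)) (fun _ => (1 : ℝ))

/-- The centered vector `P z` (in Euclidean space, so that `‖·‖` is the Euclidean norm). -/
def center {n : ℕ} (z : EuclideanSpace ℝ (Fin n)) : EuclideanSpace ℝ (Fin n) :=
  Matrix.toEuclideanCLM (𝕜 := ℝ) (centeringMatrix n) z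

/-- The standardization `χ(z) = P z / ‖P z‖`, meaningful for `z` outside the line spanned by `𝟏`;
on that line the formula returns the zero vector. -/
def chi {n : ℕ} (z : EuclideanSpace ℝ (Fin n)) : EuclideanSpace ℝ (Fin n) :=
  ‖center z‖⁻¹ • center z

/-- The linear combination `T_x(θ) = θᵀ x`. -/
def T {n : ℕ} (x θ : EuclideanSpace ℝ (Fin n)) : ℝ :=
  ∑ i, θ i * x i

/-- The matrix with `1` on the diagonal and `ρ` everywhere off the diagonal. -/
def equicorrelation (n : ℕ) (ρ : ℝ) : Matrix (Fin n) (Fin n) ℝ :=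
  Matrix.of fun i j => if i = j then 1 else ρ

/-- The confluent hypergeometric function of the first kind,
`M(a, b, z) = ∑ₖ a⁽ᵏ⁾ zᵏ / (b⁽ᵏ⁾ k!)`, where `a⁽ᵏ⁾ = a (a + 1) ⋯ (a + k - 1)`. -/
def kummerM (a b z : ℝ) : ℝ :=
  ∑' k : ℕ, ((ascPochhammer ℝ k).eval a * z ^ k) / ((ascPochhammer ℝ k).eval b * (k.factorial : ℝ))

/-- The series defining `M(a, b, z)` converges for all the parameters used below. -/
theorem summable_kummerM {a b : ℝ} (ha : 0 < a) (hab : a ≤ b) (z : ℝ) :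
    Summable fun k : ℕ => ((ascPochhammer ℝ k).eval a * z ^ k) /
      ((ascPochhammer ℝ k).eval b * (k.factorial : ℝ)) := by
  have hmono : ∀ k : ℕ, (ascPochhammer ℝ k).eval a ≤ (ascPochhammer ℝ k).eval b := by
    intro k
    induction k with
    | zero => simp
    | succ k ih =>
      rw [ascPochhammer_succ_eval, ascPochhammer_succ_eval]
      have := (ascPochhammer_pos k a ha).le
      have := (ascPochhammer_pos k b (ha.trans_le hab)).le
      gcongr
  refine Summable.of_norm_bounded (g := fun k : ℕ => |z| ^ k / (k.factorial : ℝ))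
    (Real.summable_pow_div_factorial |z|) fun k => ?_
  have h1 := ascPochhammer_pos k a ha
  have h2 := ascPochhammer_pos k b (ha.trans_le hab)
  have h3 : (0 : ℝ) < k.factorial := by positivity
  rw [Real.norm_eq_abs, abs_div, abs_mul, abs_mul, abs_pow, abs_of_pos h1, abs_of_pos h2,
    abs_of_pos h3, div_le_div_iff₀ (by positivity) h3]
  have h4 : 0 ≤ |z| ^ k * (k.factorial : ℝ) := by positivity
  nlinarith [mul_le_mul_of_nonneg_right (hmono k) h4]

/-- `ϱ_n(x) = Γ((n+1)/2) / (√2 Γ((n+2)/2)) · x · M(1/2, (n+2)/2, -x²/2)`. -/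
def varrho (n : ℕ) (x : ℝ) : ℝ :=
  Real.Gamma (((n : ℝ) + 1) / 2) / (√2 * Real.Gamma (((n : ℝ) + 2) / 2)) * x *
    kummerM (1 / 2) (((n : ℝ) + 2) / 2) (-(1 / 2) * x ^ 2)

/-- `f_n(x) = 1 - (n-1)/n · M(1, n/2 + 1, -x²/2) - ϱ_n(x)²`. -/
def f (n : ℕ) (x : ℝ) : ℝ :=
  1 - ((n : ℝ) - 1) / (n : ℝ) * kummerM 1 ((n : ℝ) / 2 + 1) (-(x ^ 2 / 2)) - (varrho n x) ^ 2

/-- `g_n(x) = 1/n · M(1, n/2 + 1, -x²/2)`. -/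
def g (n : ℕ) (x : ℝ) : ℝ :=
  1 / (n : ℝ) * kummerM 1 ((n : ℝ) / 2 + 1) (-(x ^ 2 / 2))

end Standardization

end

namespace Standardization
open Set Real
open scoped RealInnerProductSpace

/-! Centering removes the common correlation: `equicorrelation n ρ` is (1-ρ)I + ρ𝟏𝟏ᵀ, and P kills 𝟏.
So PZ has the law of c(ν + W), with c = σ√(1-ρ), cν = Pμ and W standard Gaussian on the
(n-1)-dimensional hyperplane of zero-sum vectors (`map_center_multivariateGaussian`). The scale c
cancels in the quotient, leaving the first two moments of ⟪θ, ν + W⟫ / ‖ν + W‖.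

For these, write Γ(k/2)‖x‖⁻ᵏ as the integral of t^(k/2-1) exp(-t‖x‖²) and swap integrals
(`integral_inner_div_norm_pow`). In an orthonormal basis containing θ the Gaussian expectation
factors, and completing the square turns the θ-coordinate into N(ua, u), where u = 1/(1+2t) and a =
⟪θ, ν⟫ (`integral_stdGaussian_mul_exp`). Substituting u = 1-v produces Euler integrals over (0,1).
The case k = 1 is one such integral and gives ϱ; k = 2 gives two, tied together by an integration by
parts, so both are expressed by g. -/

/-! ### Beta integrals and Euler's integral for M. -/

theorem integrableOn_beta {a b : ℝ} (ha : 0 < a) (hb : 0 < b) :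
    IntegrableOn (fun v : ℝ => v ^ (a - 1) * (1 - v) ^ (b - 1)) (Ioo 0 1) := by
  have h := lintegral_betaPDF_eq_one ha hb
  rw [lintegral_betaPDF] at h
  have hB := beta_pos ha hb
  have h1 : IntegrableOn (fun v : ℝ => 1 / beta a b * v ^ (a - 1) * (1 - v) ^ (b - 1))
      (Ioo 0 1) := by
    refine ⟨by fun_prop, ?_⟩
    rw [hasFiniteIntegral_iff_ofReal, h]
    · exact ENNReal.one_lt_top
    · filter_upwards [self_mem_ae_restrict measurableSet_Ioo] with v hv
      have := rpow_nonneg hv.1.le (a - 1)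
      have := rpow_nonneg (sub_nonneg.2 hv.2.le) (b - 1)
      simp only [Pi.zero_apply]
      positivity
  refine (h1.const_mul (beta a b)).congr (ae_of_all _ fun v => ?_)
  field_simp

theorem integral_beta {a b : ℝ} (ha : 0 < a) (hb : 0 < b) :
    ∫ v in Ioo (0 : ℝ) 1, v ^ (a - 1) * (1 - v) ^ (b - 1) = beta a b := by
  have h := lintegral_betaPDF_eq_one ha hb
  rw [lintegral_betaPDF] at h
  have hB := beta_pos ha hb
  have h1 : ∫ v in Ioo (0 : ℝ) 1, 1 / beta a b * v ^ (a - 1) * (1 - v) ^ (b - 1) = 1 := by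
    rw [integral_eq_lintegral_of_nonneg_ae, h]
    · simp
    · filter_upwards [self_mem_ae_restrict measurableSet_Ioo] with v hv
      have := rpow_nonneg hv.1.le (a - 1)
      have := rpow_nonneg (sub_nonneg.2 hv.2.le) (b - 1)
      simp only [Pi.zero_apply]
      positivity
    · fun_prop
  simp_rw [mul_assoc] at h1
  rw [integral_const_mul] at h1
  field_simp at h1
  exact h1

theorem beta_add_nat {a b : ℝ} (ha : 0 < a) (hb : 0 < b) (k : ℕ) :
    beta (a + k) b = beta a b * ((ascPochhammer ℝ k).eval a / (ascPochhammer ℝ k).eval (a + b)) := by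
  induction k with
  | zero => simp
  | succ k ih =>
    have h1 : 0 < a + k := by positivity
    have h2 : 0 < a + b + k := by positivity
    have h3 := ascPochhammer_pos k (a + b) (by positivity)
    have h4 : beta (a + (k + 1 : ℕ)) b = beta (a + k) b * ((a + k) / (a + b + k)) := by
      have e1 : a + ((k + 1 : ℕ) : ℝ) = (a + k) + 1 := by push_cast; ring
      have e2 : a + k + 1 + b = (a + b + k) + 1 := by ring
      have e3 : a + k + b = a + b + k := by ring
      rw [beta, beta, e1, e2, e3, Real.Gamma_add_one h1.ne', Real.Gamma_add_one h2.ne']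
      have := (Real.Gamma_pos_of_pos h2).ne'
      field_simp
    rw [h4, ih, ascPochhammer_succ_eval, ascPochhammer_succ_eval]
    field_simp

/-- Euler's integral representation of the confluent hypergeometric function. -/
theorem integral_euler_kummerM {a b : ℝ} (ha : 0 < a) (hb : 0 < b) (z : ℝ) :
    ∫ v in Ioo (0 : ℝ) 1, v ^ (a - 1) * (1 - v) ^ (b - 1) * exp (v * z) =
      beta a b * kummerM a (a + b) z := by
  have hterm : ∀ k : ℕ, ∀ v ∈ Ioo (0 : ℝ) 1,
      v ^ (a - 1) * (1 - v) ^ (b - 1) * ((v * z) ^ k / k.factorial) =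
      z ^ k / k.factorial * (v ^ (a + k - 1) * (1 - v) ^ (b - 1)) := by
    intro k v hv
    rw [show a + (k : ℝ) - 1 = (a - 1) + k by ring, rpow_add hv.1, rpow_natCast, mul_pow]
    ring
  have hbase := integrableOn_beta ha hb
  have hint : ∀ k : ℕ, ∫ v in Ioo (0 : ℝ) 1,
      v ^ (a - 1) * (1 - v) ^ (b - 1) * ((v * z) ^ k / k.factorial) =
      beta a b * (((ascPochhammer ℝ k).eval a * z ^ k) /
        ((ascPochhammer ℝ k).eval (a + b) * (k.factorial : ℝ))) := by
    intro k
    rw [setIntegral_congr_fun measurableSet_Ioo (hterm k), integral_const_mul,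
      integral_beta (by positivity) hb, beta_add_nat ha hb]
    have := (ascPochhammer_pos k (a + b) (by positivity)).ne'
    field_simp
  have hsum := hasSum_integral_of_dominated_convergence
    (μ := volume.restrict (Ioo (0 : ℝ) 1))
    (F := fun (k : ℕ) (v : ℝ) => v ^ (a - 1) * (1 - v) ^ (b - 1) * ((v * z) ^ k / k.factorial))
    (f := fun v => v ^ (a - 1) * (1 - v) ^ (b - 1) * exp (v * z))
    -- Since v < 1, v is dropped from |vz|ᵏ; the majorants then sum to a constant times the
    -- integrable beta weight.
    (fun k v => v ^ (a - 1) * (1 - v) ^ (b - 1) * (|z| ^ k / k.factorial))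
    (fun k => by fun_prop)
    (fun k => by
      filter_upwards [self_mem_ae_restrict measurableSet_Ioo] with v hv
      have h1 := rpow_nonneg hv.1.le (a - 1)
      have h2 := rpow_nonneg (sub_nonneg.2 hv.2.le) (b - 1)
      have h3 := hv.1.le
      rw [norm_mul, norm_of_nonneg (mul_nonneg h1 h2), norm_div, norm_pow, norm_mul,
        norm_of_nonneg hv.1.le, norm_eq_abs z, norm_natCast]
      gcongr
      exact mul_le_of_le_one_left (abs_nonneg z) hv.2.le)
    (ae_of_all _ fun v => (summable_pow_div_factorial |z|).mul_left _)
    (by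
      simp_rw [tsum_mul_left]
      exact hbase.mul_const _)
    (ae_of_all _ fun v => by
      refine HasSum.mul_left _ ?_
      rw [exp_eq_exp_ℝ]
      exact NormedSpace.expSeries_div_hasSum_exp (v * z))
  rw [← hsum.tsum_eq, kummerM, ← tsum_mul_left]
  exact tsum_congr hint

/-! ### Substitution and Gaussian tilting in one dimension. -/

/-- With t = v/(2(1-v)) one has 1/(1+2t) = 1-v, so the variance of the tilted Gaussian becomes 1-v
and the half-line becomes Euler's interval. -/
theorem integral_Ioi_comp_div_one_sub (φ : ℝ → ℝ) :
    ∫ t in Ioi (0 : ℝ), φ t =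
      ∫ v in Ioo (0 : ℝ) 1, 1 / (2 * (1 - v) ^ 2) * φ (v / (2 * (1 - v))) := by
  have himg : (fun v : ℝ => v / (2 * (1 - v))) '' Ioo 0 1 = Ioi 0 := by
    ext t
    simp only [mem_image, mem_Ioo, mem_Ioi]
    constructor
    · rintro ⟨v, ⟨h0, h1⟩, rfl⟩
      have : 0 < 1 - v := by linarith
      positivity
    · intro ht
      refine ⟨2 * t / (1 + 2 * t), ⟨by positivity, ?_⟩, ?_⟩
      · rw [div_lt_one (by positivity)]; linarith
      · field_simp
        ring
  rw [← himg, integral_image_eq_integral_abs_deriv_smul measurableSet_Ioo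
    (f' := fun v => 1 / (2 * (1 - v) ^ 2))]
  · refine setIntegral_congr_fun measurableSet_Ioo fun v hv => ?_
    have : 0 < 1 - v := by linarith [hv.2]
    simp only [smul_eq_mul]
    rw [abs_of_pos (by positivity)]
  · intro v hv
    have : 0 < 1 - v := by linarith [hv.2]
    have h := (hasDerivAt_id v).div (((hasDerivAt_id v).const_sub 1).const_mul 2)
      (by simp only [id]; positivity)
    refine (h.congr_deriv ?_).hasDerivWithinAt
    simp only [id]
    field_simp
    ring
  · intro x hx y hy hxy
    have h1 : 0 < 1 - x := by linarith [hx.2]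
    have h2 : 0 < 1 - y := by linarith [hy.2]
    simp only at hxy
    field_simp at hxy
    linarith

/-- Completing the square: a Gaussian density times exp(-tx²) is again Gaussian up to a constant,
with variance u = 1/(1+2t) and mean ua. -/
theorem integral_mul_exp_neg_sq_gaussianReal (F : ℝ → ℝ) (a : ℝ) {t : ℝ} (ht : 0 < t) :
    ∫ x, F x * exp (-t * x ^ 2) ∂(gaussianReal a 1) =
      √(1 / (1 + 2 * t)) * exp (-t * (1 / (1 + 2 * t)) * a ^ 2) *
        ∫ x, F x ∂(gaussianReal (1 / (1 + 2 * t) * a) (1 / (1 + 2 * t)).toNNReal) := by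
  have hu : 0 < 1 / (1 + 2 * t) := by positivity
  have hu' : (1 / (1 + 2 * t)).toNNReal ≠ 0 := by simpa using by positivity
  rw [integral_gaussianReal_eq_integral_smul one_ne_zero,
    integral_gaussianReal_eq_integral_smul hu', ← integral_const_mul]
  refine integral_congr_ae (ae_of_all _ fun x => ?_)
  simp only [gaussianPDFReal, smul_eq_mul, Real.coe_toNNReal _ hu.le, NNReal.coe_one]
  set u := 1 / (1 + 2 * t) with hudef
  have h1 : exp (-(x - a) ^ 2 / (2 * 1)) * exp (-t * x ^ 2) =
      exp (-t * u * a ^ 2) * exp (-(x - u * a) ^ 2 / (2 * u)) := by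
    rw [← exp_add, ← exp_add]
    congr 1
    rw [hudef]
    field_simp
    ring
  have h2 : (√(2 * π * 1))⁻¹ = √u * (√(2 * π * u))⁻¹ := by
    rw [sqrt_mul (by positivity) u, mul_one]
    have := (sqrt_pos.2 hu).ne'
    field_simp
  rw [h2]
  linear_combination (√u * (√(2 * π * u))⁻¹ * F x) * h1

theorem integral_sq_gaussianReal (a : ℝ) (v : NNReal) :
    ∫ x, x ^ 2 ∂(gaussianReal a v) = v + a ^ 2 := by
  have h := variance_eq_sub (memLp_id_gaussianReal (μ := a) (v := v) 2)
  rw [variance_id_gaussianReal] at h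
  simp only [id, integral_id_gaussianReal, Pi.pow_apply] at h
  linarith

/-! ### Negative powers as Gamma integrals. -/

/-- Gamma integral with rate r². At r = 0 both sides vanish, because y = 0 and k ≠ 0; no null-set
argument at the origin is needed later. -/
theorem integral_rpow_mul_pow_mul_exp {k : ℕ} (hk : k ≠ 0) {y r : ℝ} (hr : 0 ≤ r)
    (hy : r = 0 → y = 0) :
    ∫ t in Ioi (0 : ℝ), t ^ ((k : ℝ) / 2 - 1) * (y ^ k * exp (-t * r ^ 2)) =
      Gamma ((k : ℝ) / 2) * (y / r) ^ k := by
  rcases hr.eq_or_lt with rfl | hr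
  · simp [hy rfl, hk]
  · have hk' : 0 < (k : ℝ) / 2 := by positivity
    have h := integral_rpow_mul_exp_neg_mul_Ioi hk' (pow_pos hr 2)
    have h1 : ∀ t : ℝ, t ^ ((k : ℝ) / 2 - 1) * (y ^ k * exp (-t * r ^ 2)) =
        y ^ k * (t ^ ((k : ℝ) / 2 - 1) * exp (-(r ^ 2 * t))) := fun t => by
      rw [show -t * r ^ 2 = -(r ^ 2 * t) by ring]; ring
    simp_rw [h1]
    rw [integral_const_mul, h, ← _root_.one_div_pow, ← rpow_natCast (1 / r) 2, ← rpow_mul (by positivity),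
      show ((2 : ℕ) : ℝ) * ((k : ℝ) / 2) = k by push_cast; ring, rpow_natCast, div_pow, div_pow,
      one_pow]
    ring

theorem integrableOn_rpow_mul_pow_mul_exp {k : ℕ} (hk : k ≠ 0) {y r : ℝ} (hr : 0 ≤ r)
    (hy : r = 0 → y = 0) :
    IntegrableOn (fun t : ℝ => t ^ ((k : ℝ) / 2 - 1) * (y ^ k * exp (-t * r ^ 2))) (Ioi 0) := by
  rcases hr.eq_or_lt with rfl | hr
  · simp [hy rfl, hk]
  · have hk' : (0 : ℝ) < k := by positivity
    have h := integrableOn_rpow_mul_exp_neg_mul_rpow (s := (k : ℝ) / 2 - 1) (p := 1)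
      (by linarith) one_pos (pow_pos hr 2)
    refine (h.const_mul (y ^ k)).congr (ae_of_all _ fun t => ?_)
    simp only [rpow_one]
    rw [show -t * r ^ 2 = -r ^ 2 * t by ring]
    ring

theorem abs_inner_div_norm_le {E : Type*} [NormedAddCommGroup E] [InnerProductSpace ℝ E]
    (θ x : E) : |⟪θ, x⟫ / ‖x‖| ≤ ‖θ‖ := by
  rw [abs_div, abs_norm]
  exact div_le_of_le_mul₀ (norm_nonneg _) (norm_nonneg _) (abs_real_inner_le_norm θ x)

theorem exists_orthonormalBasis_apply_eq {E : Type*} [NormedAddCommGroup E] [InnerProductSpace ℝ E]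
    [FiniteDimensional ℝ E] {θ : E} (hθ : ‖θ‖ = 1) :
    ∃ (i₀ : Fin (Module.finrank ℝ E)) (b : OrthonormalBasis (Fin (Module.finrank ℝ E)) ℝ E),
      b i₀ = θ := by
  have hpos : 0 < Module.finrank ℝ E := by
    have : Nontrivial E := ⟨θ, 0, fun h => by simp [h] at hθ⟩
    exact Module.finrank_pos
  obtain ⟨b, hb⟩ := Orthonormal.exists_orthonormalBasis_extension_of_card_eq (𝕜 := ℝ) (E := E)
    (ι := Fin (Module.finrank ℝ E)) (by simp) (v := fun _ => θ) (s := {⟨0, hpos⟩})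
    (by
      constructor
      · intro i; simpa using hθ
      · intro i j hij
        exact absurd (Subsingleton.elim i j) hij)
  exact ⟨⟨0, hpos⟩, b, hb _ rfl⟩

/-! ### Moments of the normalized projection of a shifted Gaussian. -/

variable {E : Type*} [NormedAddCommGroup E] [InnerProductSpace ℝ E] [FiniteDimensional ℝ E]
  [MeasurableSpace E] [BorelSpace E]

/-- Fubini applies because integrating the absolute value over t gives Γ(k/2)(|⟪θ, x⟫|/‖x‖)ᵏ, which
Cauchy–Schwarz bounds uniformly in x. -/
theorem integral_inner_div_norm_pow (P : Measure E) [IsProbabilityMeasure P] (θ : E) {k : ℕ}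
    (hk : k ≠ 0) :
    Gamma ((k : ℝ) / 2) * ∫ x, (⟪θ, x⟫ / ‖x‖) ^ k ∂P =
      ∫ t in Ioi (0 : ℝ), t ^ ((k : ℝ) / 2 - 1) * ∫ x, ⟪θ, x⟫ ^ k * exp (-t * ‖x‖ ^ 2) ∂P := by
  have hz : ∀ x : E, ‖x‖ = 0 → ⟪θ, x⟫ = 0 := fun x hx => by simp [norm_eq_zero.1 hx]
  have hint : Integrable (Function.uncurry fun (x : E) (t : ℝ) =>
      t ^ ((k : ℝ) / 2 - 1) * (⟪θ, x⟫ ^ k * exp (-t * ‖x‖ ^ 2)))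
      (P.prod (volume.restrict (Ioi 0))) := by
    have hmeas : Measurable (Function.uncurry fun (x : E) (t : ℝ) =>
        t ^ ((k : ℝ) / 2 - 1) * (⟪θ, x⟫ ^ k * exp (-t * ‖x‖ ^ 2))) := by
      unfold Function.uncurry; fun_prop
    rw [integrable_prod_iff hmeas.aestronglyMeasurable]
    refine ⟨ae_of_all _ fun x =>
      integrableOn_rpow_mul_pow_mul_exp hk (norm_nonneg x) (hz x), ?_⟩
    have hnorm : ∀ x : E, ∫ t in Ioi (0 : ℝ), ‖Function.uncurry (fun (x : E) (t : ℝ) =>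
        t ^ ((k : ℝ) / 2 - 1) * (⟪θ, x⟫ ^ k * exp (-t * ‖x‖ ^ 2))) (x, t)‖ =
        Gamma ((k : ℝ) / 2) * (|⟪θ, x⟫| / ‖x‖) ^ k := by
      intro x
      rw [← integral_rpow_mul_pow_mul_exp hk (norm_nonneg x) fun h => by rw [hz x h, abs_zero]]
      refine setIntegral_congr_fun measurableSet_Ioi fun t ht => ?_
      simp only [Function.uncurry_apply_pair]
      rw [norm_mul, norm_mul, norm_pow, norm_of_nonneg (rpow_nonneg (le_of_lt ht) _),
        norm_of_nonneg (exp_pos _).le, norm_eq_abs]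
    simp_rw [hnorm]
    refine Integrable.const_mul (Integrable.of_bound (C := ‖θ‖ ^ k)
      (Measurable.aestronglyMeasurable (by fun_prop)) (ae_of_all _ fun x => ?_)) _
    rw [norm_pow, norm_div, norm_norm, norm_eq_abs, abs_abs, ← abs_norm x, ← abs_div]
    gcongr
    exact abs_inner_div_norm_le θ x
  calc
    _ = ∫ x, (∫ t in Ioi (0 : ℝ), t ^ ((k : ℝ) / 2 - 1) * (⟪θ, x⟫ ^ k * exp (-t * ‖x‖ ^ 2))) ∂P := by
      rw [← integral_const_mul]
      exact integral_congr_ae (ae_of_all _ fun x =>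
        (integral_rpow_mul_pow_mul_exp hk (norm_nonneg x) (hz x)).symm)
    _ = _ := by
      rw [integral_integral_swap hint]
      simp_rw [integral_const_mul]

theorem integral_stdGaussian_mul_exp {F : ℝ → ℝ} (hF : Measurable F) {θ : E} (hθ : ‖θ‖ = 1)
    (ν : E) {t : ℝ} (ht : 0 < t) :
    ∫ w, F ⟪θ, ν + w⟫ * exp (-t * ‖ν + w‖ ^ 2) ∂(stdGaussian E) =
      √(1 / (1 + 2 * t)) ^ Module.finrank ℝ E * exp (-t * (1 / (1 + 2 * t)) * ‖ν‖ ^ 2) *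
        ∫ x, F x ∂(gaussianReal (1 / (1 + 2 * t) * ⟪θ, ν⟫) (1 / (1 + 2 * t)).toNNReal) := by
  obtain ⟨i₀, b, rfl⟩ := exists_orthonormalBasis_apply_eq hθ
  rw [stdGaussian_eq_map_pi_orthonormalBasis b,
    integral_map (Measurable.aemeasurable (by fun_prop))
      (Measurable.aestronglyMeasurable (by fun_prop))]
  have hinner : ∀ (x : Fin (Module.finrank ℝ E) → ℝ) (i : Fin (Module.finrank ℝ E)),
      ⟪b i, ν + ∑ j, x j • b j⟫ = ⟪b i, ν⟫ + x i := fun x i => by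
    rw [inner_add_right, b.orthonormal.inner_right_fintype]
  -- Both factors split over coordinates; only the coordinate along θ carries `F`, so each other one
  -- contributes just its tilting constant.
  have hprod : ∀ x : Fin (Module.finrank ℝ E) → ℝ,
      F ⟪b i₀, ν + ∑ j, x j • b j⟫ * exp (-t * ‖ν + ∑ j, x j • b j‖ ^ 2) =
      ∏ i, (if i = i₀ then F (⟪b i, ν⟫ + x i) else 1) * exp (-t * (⟪b i, ν⟫ + x i) ^ 2) := by
    intro x
    rw [Finset.prod_mul_distrib, Finset.prod_ite_eq' Finset.univ i₀, if_pos (Finset.mem_univ _),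
      ← exp_sum, ← Finset.mul_sum, ← b.sum_sq_inner_right]
    simp_rw [hinner]
  simp_rw [hprod]
  rw [integral_fintype_prod_eq_prod (μ := fun _ : Fin (Module.finrank ℝ E) => gaussianReal 0 1)
    (f := fun i y => (if i = i₀ then F (⟪b i, ν⟫ + y) else 1) * exp (-t * (⟪b i, ν⟫ + y) ^ 2))]
  have hone : ∀ i, ∫ y, (if i = i₀ then F (⟪b i, ν⟫ + y) else 1) * exp (-t * (⟪b i, ν⟫ + y) ^ 2)
        ∂(gaussianReal 0 1) =
      √(1 / (1 + 2 * t)) * exp (-t * (1 / (1 + 2 * t)) * ⟪b i, ν⟫ ^ 2) *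
        (if i = i₀ then ∫ x, F x ∂(gaussianReal (1 / (1 + 2 * t) * ⟪b i, ν⟫)
          (1 / (1 + 2 * t)).toNNReal) else 1) := by
    intro i
    have hmap := gaussianReal_map_const_add (μ := 0) (v := 1) ⟪b i, ν⟫
    rw [zero_add] at hmap
    have h := integral_mul_exp_neg_sq_gaussianReal (fun x => if i = i₀ then F x else 1) ⟪b i, ν⟫ ht
    have hm : Measurable fun x => if i = i₀ then F x else 1 := by split_ifs <;> fun_prop
    rw [← hmap, integral_map (by fun_prop)
      (Measurable.aestronglyMeasurable (by fun_prop))] at h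
    rw [h]
    split_ifs <;> simp
  simp_rw [hone]
  rw [Finset.prod_mul_distrib, Finset.prod_mul_distrib, Finset.prod_ite_eq' Finset.univ i₀,
    if_pos (Finset.mem_univ _), ← exp_sum, ← Finset.mul_sum, b.sum_sq_inner_right]
  simp

/-- Integration by parts for (1-v)^b exp(-vy), whose boundary values are 1 at v = 0 and 0 at v = 1.
It reduces the second integral in the second moment to g. -/
theorem integral_one_sub_rpow_mul_exp {b : ℝ} (hb : 0 < b) (y : ℝ) :
    y * ∫ v in Ioo (0 : ℝ) 1, (1 - v) ^ b * exp (-(v * y)) =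
      1 - b * ∫ v in Ioo (0 : ℝ) 1, (1 - v) ^ (b - 1) * exp (-(v * y)) := by
  have hI0 : IntegrableOn (fun v : ℝ => (1 - v) ^ b) (Ioo 0 1) := by
    simpa using integrableOn_beta one_pos (add_pos hb one_pos)
  have hI1 : IntegrableOn (fun v : ℝ => (1 - v) ^ (b - 1)) (Ioo 0 1) := by
    simpa using integrableOn_beta one_pos hb
  have hexp : ∀ p : ℝ, IntegrableOn (fun v : ℝ => (1 - v) ^ p) (Ioo 0 1) →
      IntegrableOn (fun v : ℝ => (1 - v) ^ p * exp (-(v * y))) (Ioo 0 1) := by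
    intro p hp
    refine Integrable.mul_bdd (c := exp |y|) hp
      (Measurable.aestronglyMeasurable (by fun_prop)) ?_
    filter_upwards [self_mem_ae_restrict measurableSet_Ioo] with v hv
    rw [norm_of_nonneg (exp_pos _).le, exp_le_exp]
    refine (neg_le_abs _).trans ?_
    rw [abs_mul, abs_of_pos hv.1]
    exact mul_le_of_le_one_left (abs_nonneg y) hv.2.le
  have hI2 := (hexp _ hI1).const_mul (-b)
  have hI3 := (hexp _ hI0).const_mul (-y)
  -- The derivative may blow up at v = 1 when b < 1; continuity on the closed interval and an
  -- integrable derivative inside suffice.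
  have hcont : ContinuousOn (fun v : ℝ => (1 - v) ^ b * exp (-(v * y))) (Icc 0 1) := by
    refine ContinuousOn.mul (ContinuousOn.rpow_const (by fun_prop) fun _ _ => Or.inr hb.le)
      (by fun_prop)
  have hderiv : ∀ v ∈ Ioo (0 : ℝ) 1, HasDerivAt (fun v : ℝ => (1 - v) ^ b * exp (-(v * y)))
      (-b * ((1 - v) ^ (b - 1) * exp (-(v * y))) + -y * ((1 - v) ^ b * exp (-(v * y)))) v := by
    intro v hv
    have h1 : HasDerivAt (fun v : ℝ => (1 - v) ^ b) (-1 * b * (1 - v) ^ (b - 1)) v :=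
      ((hasDerivAt_id v).const_sub 1).rpow_const (Or.inl (sub_pos.2 hv.2).ne')
    have h2 : HasDerivAt (fun v : ℝ => exp (-(v * y))) (exp (-(v * y)) * -(1 * y)) v :=
      ((hasDerivAt_id v).mul_const y).neg.exp
    exact (h1.mul h2).congr_deriv (by ring)
  have hii : IntervalIntegrable (fun v : ℝ => -b * ((1 - v) ^ (b - 1) * exp (-(v * y))) +
      -y * ((1 - v) ^ b * exp (-(v * y)))) volume 0 1 :=
    (intervalIntegrable_iff_integrableOn_Ioo_of_le zero_le_one).2 (hI2.add hI3)
  have h := intervalIntegral.integral_eq_sub_of_hasDerivAt_of_le zero_le_one hcont hderiv hii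
  rw [intervalIntegral.integral_of_le zero_le_one, integral_Ioc_eq_integral_Ioo,
    integral_add hI2 hI3, integral_const_mul, integral_const_mul] at h
  simp only [sub_self, zero_rpow hb.ne', zero_mul, sub_zero, one_rpow, neg_zero, exp_zero,
    mul_one, zero_sub] at h
  linarith

/-- Euler's integral with parameters 1 and m/2, where B(1, m/2) = 2/m. -/
theorem g_eq_integral {m : ℕ} (hm : 0 < m) (s : ℝ) :
    g m s = 1 / 2 * ∫ v in Ioo (0 : ℝ) 1, (1 - v) ^ ((m : ℝ) / 2 - 1) * exp (-(v * (s ^ 2 / 2))) := by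
  have hm' : (0 : ℝ) < (m : ℝ) / 2 := by positivity
  have h := integral_euler_kummerM one_pos hm' (-(s ^ 2 / 2))
  simp only [sub_self, rpow_zero, one_mul, mul_neg] at h
  rw [h, g, beta, add_comm 1 ((m : ℝ) / 2), Real.Gamma_add_one hm'.ne', Real.Gamma_one]
  have := (Real.Gamma_pos_of_pos hm').ne'
  field_simp

theorem integral_stdGaussian_inner_div_norm_pow {k : ℕ} (hk : k ≠ 0) {θ : E} (hθ : ‖θ‖ = 1)
    (ν : E) :
    Gamma ((k : ℝ) / 2) * ∫ w, (⟪θ, ν + w⟫ / ‖ν + w‖) ^ k ∂(stdGaussian E) =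
      ∫ v in Ioo (0 : ℝ) 1, 1 / (2 * (1 - v) ^ 2) * ((v / (2 * (1 - v))) ^ ((k : ℝ) / 2 - 1) *
        (√(1 - v) ^ Module.finrank ℝ E * exp (-(v * (‖ν‖ ^ 2 / 2))) *
          ∫ x, x ^ k ∂(gaussianReal ((1 - v) * ⟪θ, ν⟫) (1 - v).toNNReal))) := by
  have hP : IsProbabilityMeasure ((stdGaussian E).map (fun w => ν + w)) :=
    Measure.isProbabilityMeasure_map (by fun_prop)
  have h := integral_inner_div_norm_pow ((stdGaussian E).map (fun w => ν + w)) θ hk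
  rw [integral_map (by fun_prop) (Measurable.aestronglyMeasurable (by fun_prop))] at h
  rw [h, integral_Ioi_comp_div_one_sub]
  refine setIntegral_congr_fun measurableSet_Ioo fun v hv => ?_
  have hv1 : 0 < 1 - v := sub_pos.2 hv.2
  have hu : 1 / (1 + 2 * (v / (2 * (1 - v)))) = 1 - v := by
    field_simp
    ring
  rw [integral_map (by fun_prop) (Measurable.aestronglyMeasurable (by fun_prop)),
    integral_stdGaussian_mul_exp (F := fun x => x ^ k) (by fun_prop) hθ ν
      (div_pos hv.1 (by positivity)), hu,
    show -(v / (2 * (1 - v))) * (1 - v) * ‖ν‖ ^ 2 = -(v * (‖ν‖ ^ 2 / 2)) by field_simp]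

theorem sqrt_pow_eq_rpow {x : ℝ} (hx : 0 ≤ x) (m : ℕ) : √x ^ m = x ^ ((m : ℝ) / 2) := by
  rw [sqrt_eq_rpow, ← rpow_natCast, ← rpow_mul hx]
  congr 1
  ring

theorem integral_stdGaussian_inner_div_norm {θ : E} (hθ : ‖θ‖ = 1) (ν : E) :
    ∫ w, ⟪θ, ν + w⟫ / ‖ν + w‖ ∂(stdGaussian E) =
      varrho (Module.finrank ℝ E) ‖ν‖ * (⟪θ, ν⟫ / ‖ν‖) := by
  have h := integral_stdGaussian_inner_div_norm_pow one_ne_zero hθ ν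
  simp only [pow_one, Nat.cast_one, integral_id_gaussianReal] at h
  set m := Module.finrank ℝ E
  have hm : (0 : ℝ) < ((m : ℝ) + 1) / 2 := by positivity
  have hE := integral_euler_kummerM (a := 1 / 2) (by norm_num) hm (-(1 / 2) * ‖ν‖ ^ 2)
  have hG : 0 < Gamma (1 / 2 : ℝ) := Real.Gamma_pos_of_pos (by norm_num)
  -- The Jacobian, t^(-1/2), the norming constant and the mean combine to the beta weight with
  -- parameters 1/2 and (m+1)/2.
  have hR : ∫ v in Ioo (0 : ℝ) 1, 1 / (2 * (1 - v) ^ 2) * ((v / (2 * (1 - v))) ^ ((1 : ℝ) / 2 - 1) *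
        (√(1 - v) ^ m * exp (-(v * (‖ν‖ ^ 2 / 2))) * ((1 - v) * ⟪θ, ν⟫))) =
      ⟪θ, ν⟫ / √2 * ∫ v in Ioo (0 : ℝ) 1, v ^ ((1 : ℝ) / 2 - 1) * (1 - v) ^ (((m : ℝ) + 1) / 2 - 1) *
        exp (v * (-(1 / 2) * ‖ν‖ ^ 2)) := by
    rw [← integral_const_mul]
    refine setIntegral_congr_fun measurableSet_Ioo fun v hv => ?_
    have hv1 : 0 < 1 - v := sub_pos.2 hv.2
    rw [div_rpow hv.1.le (by positivity), mul_rpow (by norm_num) hv1.le, sqrt_pow_eq_rpow hv1.le,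
      show ((m : ℝ) + 1) / 2 - 1 = (m : ℝ) / 2 - 1 / 2 by ring, rpow_sub hv1 (m / 2),
      show v * (-(1 / 2) * ‖ν‖ ^ 2) = -(v * (‖ν‖ ^ 2 / 2)) by ring,
      rpow_sub hv1 (1 / 2) 1, rpow_sub two_pos (1 / 2) 1, ← sqrt_eq_rpow 2, ← sqrt_eq_rpow (1 - v), rpow_one,
      rpow_one]
    have h2 : √2 ^ 2 = 2 := sq_sqrt (by norm_num)
    have h3 : √(1 - v) ^ 2 = 1 - v := sq_sqrt hv1.le
    have h4 : 0 < √(1 - v) := sqrt_pos.2 hv1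
    field_simp
  rw [hR, hE] at h
  have hb : (1 : ℝ) / 2 + ((m : ℝ) + 1) / 2 = ((m : ℝ) + 2) / 2 := by ring
  rw [beta, hb] at h
  rw [varrho]
  refine mul_left_cancel₀ hG.ne' (h.trans ?_)
  rcases eq_or_ne ν 0 with rfl | hν
  · simp
  · have := norm_ne_zero_iff.2 hν
    field_simp

theorem integral_stdGaussian_inner_div_norm_sq {θ : E} (hθ : ‖θ‖ = 1) (ν : E) :
    ∫ w, (⟪θ, ν + w⟫ / ‖ν + w‖) ^ 2 ∂(stdGaussian E) =
      (1 - Module.finrank ℝ E * g (Module.finrank ℝ E) ‖ν‖) * (⟪θ, ν⟫ / ‖ν‖) ^ 2 +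
        g (Module.finrank ℝ E) ‖ν‖ := by
  have h := integral_stdGaussian_inner_div_norm_pow two_ne_zero hθ ν
  have hpos : 0 < Module.finrank ℝ E := by
    have : Nontrivial E := ⟨θ, 0, fun h => by simp [h] at hθ⟩
    exact Module.finrank_pos
  simp only [Nat.cast_ofNat, div_self (two_ne_zero' ℝ), sub_self, rpow_zero, one_mul,
    Real.Gamma_one, integral_sq_gaussianReal] at h
  set m := Module.finrank ℝ E
  have hm : (0 : ℝ) < (m : ℝ) / 2 := by positivity
  have hparts := integral_one_sub_rpow_mul_exp hm (‖ν‖ ^ 2 / 2)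
  have hg := g_eq_integral hpos ‖ν‖
  have hI : ∀ b : ℝ, 0 < b → IntegrableOn
      (fun v : ℝ => (1 - v) ^ (b - 1) * exp (-(v * (‖ν‖ ^ 2 / 2)))) (Ioo 0 1) := by
    intro b hb
    have hI1 : IntegrableOn (fun v : ℝ => (1 - v) ^ (b - 1)) (Ioo 0 1) := by
      simpa using integrableOn_beta one_pos hb
    refine Integrable.mul_bdd (c := 1) hI1
      (Measurable.aestronglyMeasurable (by fun_prop)) ?_
    filter_upwards [self_mem_ae_restrict measurableSet_Ioo] with v hv
    rw [norm_of_nonneg (exp_pos _).le, exp_le_one_iff, neg_nonpos]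
    exact mul_nonneg hv.1.le (by positivity)
  have hI0 := hI _ (add_pos hm one_pos)
  simp only [add_sub_cancel_right] at hI0
  -- The second moment of N((1-v)a, 1-v) splits: its variance yields g, its squared mean the
  -- integral treated by parts.
  have hR : ∫ v in Ioo (0 : ℝ) 1, 1 / (2 * (1 - v) ^ 2) *
        (√(1 - v) ^ m * exp (-(v * (‖ν‖ ^ 2 / 2))) *
          (((1 - v).toNNReal : ℝ) + ((1 - v) * ⟪θ, ν⟫) ^ 2)) =
      1 / 2 * (∫ v in Ioo (0 : ℝ) 1, (1 - v) ^ ((m : ℝ) / 2 - 1) * exp (-(v * (‖ν‖ ^ 2 / 2)))) +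
      ⟪θ, ν⟫ ^ 2 / 2 *
        ∫ v in Ioo (0 : ℝ) 1, (1 - v) ^ ((m : ℝ) / 2) * exp (-(v * (‖ν‖ ^ 2 / 2))) := by
    rw [← integral_const_mul, ← integral_const_mul,
      ← integral_add ((hI _ hm).const_mul _) (hI0.const_mul _)]
    refine setIntegral_congr_fun measurableSet_Ioo fun v hv => ?_
    have hv1 : 0 < 1 - v := sub_pos.2 hv.2
    rw [Real.coe_toNNReal _ hv1.le, sqrt_pow_eq_rpow hv1.le, rpow_sub hv1, rpow_one]
    field_simp
  rw [hR, ← hg] at h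
  rw [h]
  rcases eq_or_ne ν 0 with rfl | hν
  · simp
  · have := norm_ne_zero_iff.2 hν
    have key : 1 - m * g m ‖ν‖ = ‖ν‖ ^ 2 / 2 *
        ∫ v in Ioo (0 : ℝ) 1, (1 - v) ^ ((m : ℝ) / 2) * exp (-(v * (‖ν‖ ^ 2 / 2))) := by
      rw [hparts, hg]; ring
    rw [key]
    generalize ∫ v in Ioo (0 : ℝ) 1, (1 - v) ^ ((m : ℝ) / 2) * exp (-(v * (‖ν‖ ^ 2 / 2))) = J
    field_simp
    ring

/-! ### Centering and the equicorrelated Gaussian law. -/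

variable {n : ℕ}

theorem center_apply (z : EuclideanSpace ℝ (Fin n)) (i : Fin n) :
    center z i = z i - 1 / (n : ℝ) * ∑ j, z j := by
  simp [center, centeringMatrix, Matrix.vecMulVec_mulVec, dotProduct]

theorem sum_center (z : EuclideanSpace ℝ (Fin n)) : ∑ i, center z i = 0 := by
  rcases n.eq_zero_or_pos with rfl | hn
  · simp
  · simp only [center_apply, Finset.sum_sub_distrib, Finset.sum_const, Finset.card_univ,
      Fintype.card_fin, nsmul_eq_mul]
    field_simp
    ring

theorem inner_center_of_sum_eq_zero {t : EuclideanSpace ℝ (Fin n)} (ht : ∑ i, t i = 0)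
    (z : EuclideanSpace ℝ (Fin n)) : ⟪t, center z⟫ = ⟪t, z⟫ := by
  simp only [PiLp.inner_apply, RCLike.inner_apply, conj_trivial, center_apply, sub_mul,
    Finset.sum_sub_distrib, ← Finset.mul_sum, ht, mul_zero, sub_zero]

theorem inner_center_left (x y : EuclideanSpace ℝ (Fin n)) : ⟪center x, y⟫ = ⟪x, center y⟫ := by
  rw [← inner_center_of_sum_eq_zero (sum_center x), real_inner_comm,
    inner_center_of_sum_eq_zero (sum_center y), real_inner_comm]

theorem measurable_center : Measurable (center : EuclideanSpace ℝ (Fin n) → _) :=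
  (toEuclideanCLM (𝕜 := ℝ) (centeringMatrix n)).continuous.measurable

/-- The hyperplane of vectors whose coordinates sum to zero. -/
noncomputable abbrev sumZero (n : ℕ) : Submodule ℝ (EuclideanSpace ℝ (Fin n)) :=
  (ℝ ∙ (WithLp.toLp 2 fun _ : Fin n => (1 : ℝ)))ᗮ

theorem mem_sumZero {z : EuclideanSpace ℝ (Fin n)} : z ∈ sumZero n ↔ ∑ i, z i = 0 := by
  rw [Submodule.mem_orthogonal_singleton_iff_inner_right]
  simp [PiLp.inner_apply]

theorem finrank_sumZero (hn : 0 < n) : Module.finrank ℝ (sumZero n) = n - 1 := by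
  have : Fact (Module.finrank ℝ (EuclideanSpace ℝ (Fin n)) = (n - 1) + 1) :=
    ⟨by rw [finrank_euclideanSpace_fin]; omega⟩
  refine Submodule.finrank_orthogonal_span_singleton fun h => ?_
  have := congrArg (fun z : EuclideanSpace ℝ (Fin n) => z ⟨0, hn⟩) h
  simp at this

theorem dotProduct_equicorrelation_mulVec (ρ : ℝ) (x : Fin n → ℝ) :
    x ⬝ᵥ equicorrelation n ρ *ᵥ x = (1 - ρ) * ∑ i, x i ^ 2 + ρ * (∑ i, x i) ^ 2 := by
  have h : ∀ i, (equicorrelation n ρ *ᵥ x) i = (1 - ρ) * x i + ρ * ∑ j, x j := by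
    intro i
    have h1 : ∀ j, equicorrelation n ρ i j * x j = (if i = j then (1 - ρ) * x j else 0) + ρ * x j := by
      intro j
      simp only [equicorrelation, Matrix.of_apply]
      split_ifs <;> ring
    simp only [Matrix.mulVec, dotProduct, h1, Finset.sum_add_distrib, Finset.sum_ite_eq,
      Finset.mem_univ, if_true, Finset.mul_sum]
  simp only [dotProduct, h, mul_add, Finset.sum_add_distrib]
  rw [← Finset.sum_mul, Finset.mul_sum (f := fun i => x i ^ 2)]
  congr 1
  · exact Finset.sum_congr rfl fun i _ => by ring
  · ring

theorem posSemidef_equicorrelation {ρ : ℝ} (hn : 0 < n) (hρ : -(1 / (n : ℝ)) < ρ) (hρ' : ρ < 1) :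
    (equicorrelation n ρ).PosSemidef := by
  refine Matrix.PosSemidef.of_dotProduct_mulVec_nonneg ?_ fun x => ?_
  · ext i j
    simp [equicorrelation, eq_comm]
  · rw [star_trivial, dotProduct_equicorrelation_mulVec]
    have hcs : (∑ i, x i) ^ 2 ≤ n * ∑ i, x i ^ 2 := by
      simpa using sq_sum_le_card_mul_sum_sq (s := Finset.univ) (f := x)
    have hn' : (0 : ℝ) < n := by exact_mod_cast hn
    have hS : 0 ≤ ∑ i, x i ^ 2 := Finset.sum_nonneg fun i _ => sq_nonneg _
    have h1 : -1 < ρ * n := by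
      have := mul_lt_mul_of_pos_right hρ hn'
      rwa [neg_mul, one_div, inv_mul_cancel₀ hn'.ne'] at this
    rcases le_or_gt 0 ρ with h0 | h0
    · have := mul_nonneg (sub_nonneg.2 hρ'.le) hS
      positivity
    -- For ρ < 0, Cauchy–Schwarz bounds the form below by (1-ρ+ρn)∑xᵢ², and ρn > -1 makes this
    -- factor positive.
    · nlinarith [mul_nonneg hS (by linarith : 0 ≤ 1 - ρ + ρ * n)]

/-- Centering an equicorrelated Gaussian vector yields a shifted and scaled standard Gaussian vector
on the hyperplane of vectors with zero sum. -/
theorem map_center_multivariateGaussian (hn : 0 < n) (μ : EuclideanSpace ℝ (Fin n)) {σ ρ : ℝ}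
    (hρ : -(1 / (n : ℝ)) < ρ) (hρ' : ρ < 1) (ν : sumZero n)
    (hν : (σ * √(1 - ρ)) • (ν : EuclideanSpace ℝ (Fin n)) = center μ) :
    (multivariateGaussian μ (σ ^ 2 • equicorrelation n ρ)).map center =
      (stdGaussian (sumZero n)).map
        (fun w => (σ * √(1 - ρ)) • ((ν + w : sumZero n) : EuclideanSpace ℝ (Fin n))) := by
  have h1 : IsProbabilityMeasure
      ((multivariateGaussian μ (σ ^ 2 • equicorrelation n ρ)).map center) :=
    Measure.isProbabilityMeasure_map measurable_center.aemeasurable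
  have h2 : IsProbabilityMeasure ((stdGaussian (sumZero n)).map
        (fun w => (σ * √(1 - ρ)) • ((ν + w : sumZero n) : EuclideanSpace ℝ (Fin n)))) :=
    Measure.isProbabilityMeasure_map (Measurable.aemeasurable (by fun_prop))
  apply Measure.ext_of_charFun
  ext t
  set c := σ * √(1 - ρ) with hc
  have hc2 : c ^ 2 = σ ^ 2 * (1 - ρ) := by rw [hc, mul_pow, sq_sqrt (by linarith)]
  -- P is self-adjoint, so it moves onto the frequency t.
  have hL : charFun ((multivariateGaussian μ (σ ^ 2 • equicorrelation n ρ)).map center) t =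
      charFun (multivariateGaussian μ (σ ^ 2 • equicorrelation n ρ)) (center t) := by
    rw [charFun_apply, charFun_apply, integral_map measurable_center.aemeasurable
      (Measurable.aestronglyMeasurable (by fun_prop))]
    simp_rw [inner_center_left]
  have htH : center t ∈ sumZero n := mem_sumZero.2 (sum_center t)
  have hR : charFun ((stdGaussian (sumZero n)).map
        (fun w => c • ((ν + w : sumZero n) : EuclideanSpace ℝ (Fin n)))) t =
      Complex.exp (⟪center μ, t⟫ * Complex.I) *
        charFun (stdGaussian (sumZero n)) (c • ⟨center t, htH⟩) := by
    rw [charFun_apply, charFun_apply, integral_map (Measurable.aemeasurable (by fun_prop))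
      (Measurable.aestronglyMeasurable (by fun_prop)), ← integral_const_mul]
    refine integral_congr_ae (ae_of_all _ fun w => ?_)
    simp only
    rw [← Complex.exp_add, ← add_mul, ← Complex.ofReal_add]
    congr 3
    have hw := mem_sumZero.1 w.2
    rw [Submodule.coe_inner, Submodule.coe_smul, Submodule.coe_add, smul_add, inner_add_left, hν,
      inner_smul_left, inner_smul_right, inner_center_of_sum_eq_zero hw]
    simp
  rw [hL, hR, charFun_stdGaussian, charFun_multivariateGaussian
    ((posSemidef_equicorrelation hn hρ hρ').smul (sq_nonneg σ)), ← Complex.exp_add]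
  -- Pt has zero sum, so the ρ𝟏𝟏ᵀ part of the covariance drops out and only c² = σ²(1-ρ) remains.
  have hq : (center t).ofLp ⬝ᵥ (σ ^ 2 • equicorrelation n ρ) *ᵥ (center t).ofLp =
      c ^ 2 * ‖center t‖ ^ 2 := by
    rw [Matrix.smul_mulVec, dotProduct_smul, dotProduct_equicorrelation_mulVec, sum_center,
      EuclideanSpace.real_norm_sq_eq, hc2, smul_eq_mul]
    ring
  have hnorm : ‖c • (⟨center t, htH⟩ : sumZero n)‖ ^ 2 = c ^ 2 * ‖center t‖ ^ 2 := by
    rw [norm_smul, mul_pow, norm_eq_abs, sq_abs]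
    rfl
  rw [← Complex.ofReal_pow ‖_‖, hnorm, hq, inner_center_left, real_inner_comm]
  congr 1
  push_cast
  ring

theorem T_chi_eq (z θ : EuclideanSpace ℝ (Fin n)) : T (chi z) θ = ⟪θ, center z⟫ / ‖center z‖ := by
  rw [div_eq_inv_mul, ← real_inner_smul_right]
  simp [T, chi, PiLp.inner_apply, mul_comm]

end Standardization

/-! ### Assembling the variance. -/

theorem mainTheorem2 {Ω : Type*} [MeasurableSpace Ω] (Pr : Measure Ω) [IsProbabilityMeasure Pr]
    (n : ℕ) (μ : EuclideanSpace ℝ (Fin n)) (σ ρ : ℝ) (hσ : 0 < σ)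
    (hρ : -(1 / (n : ℝ)) < ρ) (hρ' : ρ < 1)
    (Z : Ω → EuclideanSpace ℝ (Fin n))
    (hZ : HasLaw Z (multivariateGaussian μ (σ ^ 2 • Standardization.equicorrelation n ρ)) Pr)
    (θ : EuclideanSpace ℝ (Fin n)) (hθ : ‖θ‖ = 1) (hθ' : ∑ i, θ i = 0) :
    variance (fun ω => Standardization.T (Standardization.chi (Z ω)) θ) Pr =
      (Standardization.f (n - 1) (‖Standardization.center μ‖ / (σ * √(1 - ρ))) -
        Standardization.g (n - 1) (‖Standardization.center μ‖ / (σ * √(1 - ρ)))) *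
          (∑ i, Standardization.chi μ i * θ i) ^ 2 +
        Standardization.g (n - 1) (‖Standardization.center μ‖ / (σ * √(1 - ρ))) := by
  open Standardization in
  have hn : 0 < n := by
    rcases n.eq_zero_or_pos with rfl | h
    · simp [Subsingleton.elim θ 0] at hθ
    · exact h
  have hc : 0 < σ * √(1 - ρ) := mul_pos hσ (Real.sqrt_pos.2 (by linarith))
  set c := σ * √(1 - ρ) with hcdef
  set s := ‖center μ‖ / c with hs
  let ν : sumZero n := ⟨c⁻¹ • center μ, (sumZero n).smul_mem _ (mem_sumZero.2 (sum_center μ))⟩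
  let θ₀ : sumZero n := ⟨θ, mem_sumZero.2 hθ'⟩
  have hν : c • (ν : EuclideanSpace ℝ (Fin n)) = center μ := smul_inv_smul₀ hc.ne' _
  have hνs : ‖ν‖ = s := by
    change ‖c⁻¹ • center μ‖ = s
    rw [norm_smul, norm_inv, Real.norm_of_nonneg hc.le, hs, div_eq_inv_mul]
  have hνθ : inner ℝ θ₀ ν / ‖ν‖ = inner ℝ θ (center μ) / ‖center μ‖ := by
    change inner ℝ θ (c⁻¹ • center μ) / ‖c⁻¹ • center μ‖ = _
    rw [real_inner_smul_right, norm_smul, norm_inv, Real.norm_of_nonneg hc.le,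
      mul_div_mul_left _ _ (inv_ne_zero hc.ne')]
  have hfin := finrank_sumZero hn
  have hθ₀ : ‖θ₀‖ = 1 := hθ
  -- A unit vector in the hyperplane forces dimension at least 1, so n ≥ 2: the truncated
  -- subtraction is harmless and division by n-1 is legitimate.
  have hm : 1 ≤ n - 1 := by
    have : Nontrivial (sumZero n) := ⟨θ₀, 0, fun h => by simp [h] at hθ₀⟩
    have := Module.finrank_pos (R := ℝ) (M := sumZero n)
    omega
  have hlaw := map_center_multivariateGaussian hn μ hρ hρ' ν hν
  have hmeas : ∀ k : ℕ, Measurable fun x : EuclideanSpace ℝ (Fin n) => (inner ℝ θ x / ‖x‖) ^ k :=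
    fun k => by fun_prop
  -- The quotient is invariant under scaling by c > 0, and the hyperplane inherits its inner product
  -- and norm.
  have hint : ∀ k : ℕ, ∫ ω, (T (chi (Z ω)) θ) ^ k ∂Pr =
      ∫ w, (inner ℝ θ₀ (ν + w) / ‖ν + w‖) ^ k ∂(stdGaussian (sumZero n)) := by
    intro k
    have h1 := hZ.integral_comp (f := fun z => (T (chi z) θ) ^ k)
      (by simp_rw [T_chi_eq]
          exact ((hmeas k).comp measurable_center).aestronglyMeasurable)
    have h2 := congrArg (fun P => ∫ x, (inner ℝ θ x / ‖x‖) ^ k ∂P) hlaw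
    rw [integral_map measurable_center.aemeasurable (hmeas k).aestronglyMeasurable,
      integral_map (Measurable.aemeasurable (by fun_prop)) (hmeas k).aestronglyMeasurable] at h2
    refine h1.trans ?_
    simp_rw [T_chi_eq]
    rw [h2]
    refine integral_congr_ae (ae_of_all _ fun w => ?_)
    simp only
    rw [real_inner_smul_right, norm_smul, Real.norm_of_nonneg hc.le,
      mul_div_mul_left _ _ hc.ne']
    rfl
  have hLp : MemLp (fun ω => T (chi (Z ω)) θ) 2 Pr := by
    refine MemLp.of_bound ?_ ‖θ‖ (ae_of_all _ fun ω => ?_)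
    · simp_rw [T_chi_eq]
      have h1 := ((hmeas 1).comp measurable_center).comp_aemeasurable hZ.aemeasurable
      simpa [Function.comp_def] using h1.aestronglyMeasurable
    · rw [T_chi_eq]
      exact abs_inner_div_norm_le _ _
  have h1 := hint 1
  have h2 := hint 2
  simp only [pow_one] at h1
  rw [integral_stdGaussian_inner_div_norm hθ₀, hfin, hνθ, hνs] at h1
  rw [integral_stdGaussian_inner_div_norm_sq hθ₀, hfin, hνθ, hνs] at h2
  have hchi : ∑ i, chi μ i * θ i = inner ℝ θ (center μ) / ‖center μ‖ := by
    rw [← T_chi_eq]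
    simp [T, mul_comm]
  rw [variance_eq_sub hLp, h1, hchi]
  simp only [Pi.pow_apply]
  rw [h2]
  have hm' : ((n - 1 : ℕ) : ℝ) ≠ 0 := by
    have : 0 < n - 1 := hm
    positivity
  -- With m = n-1, f - g = 1 - m·g - ϱ², which is the coefficient left after subtracting the squared
  -- mean.
  simp only [f, g]
  field_simp
  ring
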